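/- For a finite connected graph $G=(V,E)$ with $|V|\ge 2$ and distance matrix $D=[d(i,j)]_{i,j\in V}$ ($d$ the graph distance), the quadratic embedding constant of $G$ is $$\mathrm{QEC}(G)=\max\{\langle f,Df\rangle : f\in\mathbb{R}^V,\ \langle f,f\rangle=1,\ \langle \mathbf 1,f\rangle=0\},$$ where $\mathbf 1$ is the all-ones vector. Let $P_n$ be the path on $n$ vertices, $A_n$ its adjacency matrix, $\mathrm{ev}(A_n)$ the set of eigenvalues of $A_n$, and let $K_1+P_n$ be the fan graph, that is, the join of a single vertex with $P_n$ (one new vertex adjacent to all vertices of $P_n$). Let $U_n$ be the Chebyshev polynomial of the second kind, $U_n(\cos\theta)=\sin((n+1)\theta)/\sin\theta$, put $\tilde U_n(x)=U_n(x/2)$, and for $n\ge1$ define $$\Phi_n(x)=((n+1)x^2-6x-4n)\,\tilde U_n(x)+2(x+2)\,\tilde U_{n-1}(x)+2(x+2).$$ **Theorem.** Let $n\ge1$. Then $\Phi_n$ has a smallest real root $\tilde\alpha_n$, and $$\mathrm{QEC}(K_1+P_n)=-\tilde\alpha_n-2.$$ If $n$ is even, then $\tilde\alpha_n=\min\mathrm{ev}(A_n)=-2\cos\frac{\pi}{n+1}$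 and $$\mathrm{QEC}(K_1+P_n)=-\min\mathrm{ev}(A_n)-2=-4\sin^2\frac{\pi}{2(n+1)}.$$ If $n$ is odd, then $\min\mathrm{ev}(A_{n+1})\le\tilde\alpha_n<\min\mathrm{ev}(A_n)$ and $$-4\sin^2\frac{\pi}{2(n+1)}<\mathrm{QEC}(K_1+P_n)\le-4\sin^2\frac{\pi}{2(n+2)}.$$ -/

import Mathlib

open Polynomial Matrix

noncomputable section

namespace QEFan

/-- The join of two graphs: their disjoint union together with all edges between the two parts. -/
def join {V W : Type*} (G : SimpleGraph V) (H : SimpleGraph W) : SimpleGraph (V ⊕ W) :=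
  (G ⊕g H) ⊔ completeBipartiteGraph V W

/-- The fan graph `K₁ + Pₙ`; `K₁` is the complete graph on one vertex. -/
def fan (n : ℕ) : SimpleGraph (Fin 1 ⊕ Fin n) :=
  join (⊤ : SimpleGraph (Fin 1)) (SimpleGraph.pathGraph n)

/-- The distance matrix of a graph. -/
def distMatrix {V : Type*} (G : SimpleGraph V) : Matrix V V ℝ :=
  Matrix.of fun i j => (G.dist i j : ℝ)

/-- The values `⟨f, D f⟩` over the real vectors with `⟨f, f⟩ = 1` and `⟨1, f⟩ = 0`. -/
def qeValues {V : Type*} [Fintype V] (G : SimpleGraph V) : Set ℝ :=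
  {t | ∃ f : V → ℝ, f ⬝ᵥ f = 1 ∧ (1 : V → ℝ) ⬝ᵥ f = 0 ∧ t = f ⬝ᵥ (distMatrix G *ᵥ f)}

/-- The quadratic embedding constant. For a connected graph on at least two vertices
the supremum is a maximum. -/
def QEC {V : Type*} [Fintype V] (G : SimpleGraph V) : ℝ :=
  sSup (qeValues G)

open Classical in
/-- The set of eigenvalues of the adjacency matrix of the path on `n` vertices. -/
def evPath (n : ℕ) : Set ℝ :=
  {a | Module.End.HasEigenvalue (Matrix.toLin' ((SimpleGraph.pathGraph n).adjMatrix ℝ)) a}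

/-- The compressed Chebyshev polynomial of the second kind, `Uₖ(x / 2)`. -/
def chebU (k : ℤ) : ℝ[X] :=
  (Polynomial.Chebyshev.U ℝ k).comp (C (1 / 2) * X)

/-- `Φₙ(x) = ((n+1)x² - 6x - 4n) Ũₙ(x) + 2(x+2) Ũₙ₋₁(x) + 2(x+2)`. -/
def fanPoly (n : ℕ) : ℝ[X] :=
  (C ((n : ℝ) + 1) * X ^ 2 - C 6 * X - C (4 * (n : ℝ))) * chebU n
    + C 2 * (X + C 2) * chebU ((n : ℤ) - 1) + C 2 * (X + C 2)

end QEFan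

end

/-! Let `s` be the sum of the entries on the path. The orthogonality constraint forces the hub
coordinate to be `-s`, and distances within the path are 1 or 2, so the problem becomes minimising
the quotient of `A - 2J` by `I + J`, where `A` is the path's adjacency matrix and `J` is all ones.
Its minimum `α = -QEC - 2` is the least `x` at which `pencil n x = (A - 2J) - x(I + J)` is singular
(`mem_qeValues_fan_iff`, `isLeast_isRoot_fanPoly`).

A kernel vector of the pencil solves a three-term recurrence with constant term proportional to `s`.
The boundary condition and the definition of `s` give a 2×2 system with determinant `-Φₙ(x)`; hence
singularity means a root of `Φₙ`, away from `x = 2` (`fanPoly_isRoot_iff`).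

To locate the root, put `x = -2 cos 2φ`. Then `sin φ · Φₙ(x)` has a factor `cos ((n+1)φ)` for even
`n` and `sin ((n+1)φ)` for odd `n`. The sign of the cofactor for small `φ` rests on
`mul_sin_sq_le_one`; for odd `n` a sign change yields a root below `min ev(Aₙ)`. -/

noncomputable section

namespace QEFan

/-! ### Chebyshev values as a linear recurrence -/

/-- The values `Ũₖ₋₁(x)`, indexed so that the sequence starts with `0, 1`. -/
def chebSeq (x : ℝ) (k : ℕ) : ℝ := (chebU ((k : ℤ) - 1)).eval x

lemma chebSeq_zero (x : ℝ) : chebSeq x 0 = 0 := by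
  simp [chebSeq, chebU]

lemma chebSeq_one (x : ℝ) : chebSeq x 1 = 1 := by
  simp [chebSeq, chebU]

lemma chebSeq_add_two (x : ℝ) (k : ℕ) :
    chebSeq x (k + 2) = x * chebSeq x (k + 1) - chebSeq x k := by
  have h := Polynomial.Chebyshev.U_add_two ℝ ((k : ℤ) - 1)
  have e1 : (((k + 2 : ℕ) : ℤ) - 1) = (k : ℤ) - 1 + 2 := by push_cast; ring
  have e2 : (((k + 1 : ℕ) : ℤ) - 1) = (k : ℤ) - 1 + 1 := by push_cast; ring
  simp only [chebSeq, chebU, e1, e2, h]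
  simp

/-- The form is an invariant of the recurrence, whose transfer matrix has determinant 1. -/
lemma chebSeq_quadratic (x : ℝ) (k : ℕ) :
    chebSeq x (k + 1) ^ 2 + chebSeq x k ^ 2 - x * chebSeq x k * chebSeq x (k + 1) = 1 := by
  induction k with
  | zero => simp [chebSeq_zero, chebSeq_one]
  | succ k ih => rw [chebSeq_add_two]; linear_combination ih

lemma chebSeq_neg (x : ℝ) (k : ℕ) :
    chebSeq (-x) (k + 1) = (-1) ^ k * chebSeq x (k + 1) ∧
      chebSeq (-x) k = -(-1) ^ k * chebSeq x k := by
  induction k with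
  | zero => simp [chebSeq_zero, chebSeq_one]
  | succ k ih =>
    refine ⟨?_, ?_⟩
    · rw [chebSeq_add_two, chebSeq_add_two, ih.1, ih.2]; ring
    · rw [ih.1]; ring

lemma chebSeq_cos (θ : ℝ) (k : ℕ) :
    chebSeq (2 * Real.cos θ) k * Real.sin θ = Real.sin (k * θ) := by
  have h : chebSeq (2 * Real.cos θ) k * Real.sin θ = Real.sin (k * θ) ∧
      chebSeq (2 * Real.cos θ) (k + 1) * Real.sin θ = Real.sin ((k + 1 : ℕ) * θ) := by
    induction k with
    | zero => simp [chebSeq_zero, chebSeq_one]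
    | succ k ih =>
      refine ⟨ih.2, ?_⟩
      have e1 : ((k + 1 + 1 : ℕ) : ℝ) * θ = (k + 1 : ℕ) * θ + θ := by push_cast; ring
      have e2 : (k : ℝ) * θ = (k + 1 : ℕ) * θ - θ := by push_cast; ring
      have h1 := ih.1
      rw [e2, Real.sin_sub] at h1
      rw [e1, Real.sin_add, chebSeq_add_two]
      linear_combination 2 * Real.cos θ * ih.2 - h1
  exact h.1

lemma chebSeq_growth {x : ℝ} (hx : 2 ≤ x) (k : ℕ) :
    (k : ℝ) ≤ chebSeq x k ∧ 1 ≤ chebSeq x (k + 1) - chebSeq x k := by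
  induction k with
  | zero => simp [chebSeq_zero, chebSeq_one]
  | succ k ih =>
    have h0 : (0 : ℝ) ≤ k := k.cast_nonneg
    have h1 : (k : ℝ) + 1 ≤ chebSeq x (k + 1) := by linarith [ih.1, ih.2]
    refine ⟨by push_cast; exact h1, ?_⟩
    rw [chebSeq_add_two]
    nlinarith [ih.2]

lemma fanPoly_eval (n : ℕ) (x : ℝ) :
    (fanPoly n).eval x = ((n + 1) * x ^ 2 - 6 * x - 4 * n) * chebSeq x (n + 1)
      + 2 * (x + 2) * chebSeq x n + 2 * (x + 2) := by
  have e : (((n + 1 : ℕ) : ℤ) - 1) = n := by push_cast; ring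
  simp [fanPoly, chebSeq]

/-! ### The adjacency matrix of a path -/

/-- A vector on the path, extended by zero on both sides. -/
lemma exists_extension {n : ℕ} (g : Fin n → ℝ) :
    ∃ G : ℕ → ℝ, G 0 = 0 ∧ G (n + 1) = 0 ∧ g = fun i : Fin n => G (i + 1) := by
  refine ⟨fun k => if h : 1 ≤ k ∧ k - 1 < n then g ⟨k - 1, h.2⟩ else 0, by simp, by simp, ?_⟩
  ext i
  simp

lemma adjMatrix_pathGraph_mulVec {n : ℕ} [DecidableRel (SimpleGraph.pathGraph n).Adj]
    {G : ℕ → ℝ} (h0 : G 0 = 0) (hn : G (n + 1) = 0) (i : Fin n) :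
    ((SimpleGraph.pathGraph n).adjMatrix ℝ *ᵥ fun j : Fin n => G (j + 1)) i
      = G i + G (i + 2) := by
  have hsplit : ∀ j : Fin n,
      (SimpleGraph.pathGraph n).adjMatrix ℝ i j * G (j + 1)
        = (if (j : ℕ) + 1 = i then G (j + 1) else 0)
          + (if (j : ℕ) = i + 1 then G (j + 1) else 0) := by
    intro j
    simp only [SimpleGraph.adjMatrix_apply, SimpleGraph.pathGraph_adj]
    split_ifs <;> first | omega | simp
  simp only [mulVec, dotProduct, hsplit, Finset.sum_add_distrib]
  congr 1
  · rw [Fin.sum_univ_eq_sum_range (fun j => if j + 1 = (i : ℕ) then G (j + 1) else 0) n]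
    rcases hi : (i : ℕ) with _ | k
    · simp [h0]
    · have : k < n := by omega
      simp [this]
  · rw [Fin.sum_univ_eq_sum_range (fun j => if j = (i : ℕ) + 1 then G (j + 1) else 0) n]
    rw [Finset.sum_ite_eq' (Finset.range n) ((i : ℕ) + 1) (fun j => G (j + 1))]
    split_ifs with h
    · rfl
    · have : (i : ℕ) + 2 = n + 1 := by have := i.2; simp at h; omega
      rw [this, hn]

/-! ### Solving the path recurrence, with and without a constant term -/

/-- The solution of `x qₖ₊₁ - qₖ - qₖ₊₂ = 1` that starts with `0, 0`. -/
def forcedSeq (x : ℝ) (k : ℕ) : ℝ :=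
  -- The inner bracket is the term before `chebSeq x k`, in a form that also makes sense at `k = 0`.
  -- The constant `1 / (x - 2)` is a particular solution.
  (1 - chebSeq x k + (x * chebSeq x k - chebSeq x (k + 1))) / (x - 2)

lemma forcedSeq_zero (x : ℝ) : forcedSeq x 0 = 0 := by
  simp [forcedSeq, chebSeq_zero, chebSeq_one]

lemma forcedSeq_one (x : ℝ) : forcedSeq x 1 = 0 := by
  simp [forcedSeq, chebSeq_add_two, chebSeq_zero, chebSeq_one]

lemma forcedSeq_add_two {x : ℝ} (hx : x ≠ 2) (k : ℕ) :
    forcedSeq x (k + 2) = x * forcedSeq x (k + 1) - forcedSeq x k - 1 := by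
  have : x - 2 ≠ 0 := sub_ne_zero.2 hx
  simp only [forcedSeq, chebSeq_add_two]
  field_simp
  ring

lemma forcedSeq_succ {x : ℝ} (hx : x ≠ 2) (k : ℕ) :
    (x - 2) * forcedSeq x (k + 1) = 1 - chebSeq x (k + 1) + chebSeq x k := by
  have : x - 2 ≠ 0 := sub_ne_zero.2 hx
  simp only [forcedSeq, chebSeq_add_two]
  field_simp
  ring

lemma sum_chebSeq (x : ℝ) (n : ℕ) :
    (x - 2) * ∑ i ∈ Finset.range n, chebSeq x (i + 1)
      = chebSeq x (n + 1) - chebSeq x n - 1 := by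
  induction n with
  | zero => simp [chebSeq_zero, chebSeq_one]
  | succ n ih => rw [Finset.sum_range_succ, mul_add, ih, chebSeq_add_two]; ring

lemma sum_forcedSeq {x : ℝ} (hx : x ≠ 2) (n : ℕ) :
    (x - 2) * ∑ i ∈ Finset.range n, forcedSeq x (i + 1) = n - chebSeq x n := by
  induction n with
  | zero => simp [chebSeq_zero]
  | succ n ih => rw [Finset.sum_range_succ, mul_add, ih, forcedSeq_succ hx]; push_cast; ring

/-- Subtracting the particular solution `q` leaves a homogeneous solution vanishing at 0, which is a
multiple of `chebSeq`. The recurrence for `i < n` reaches index `n + 1`, where the boundary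
condition sits. -/
lemma eq_of_recurrence {x c : ℝ} {n : ℕ} {G q : ℕ → ℝ} (h0 : G 0 = 0)
    (hG : ∀ i < n, G (i + 2) = x * G (i + 1) - G i - c)
    (hq0 : q 0 = 0) (hq1 : q 1 = 0) (hq : ∀ i, q (i + 2) = x * q (i + 1) - q i - c) (k : ℕ)
    (hk : k ≤ n + 1) : G k = G 1 * chebSeq x k + q k := by
  induction k using Nat.twoStepInduction with
  | zero => simp [h0, chebSeq_zero, hq0]
  | one => simp [chebSeq_one, hq1]
  | more k ih1 ih2 =>
    rw [hG k (by omega), hq, chebSeq_add_two, ih1 (by omega), ih2 (by omega)]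
    ring

lemma mem_evPath_iff {n : ℕ} (hn : 1 ≤ n) (x : ℝ) :
    x ∈ evPath n ↔ chebSeq x (n + 1) = 0 := by
  classical
  constructor
  · intro h
    obtain ⟨g, hg⟩ := Module.End.HasEigenvalue.exists_hasEigenvector h
    have hgA := hg.apply_eq_smul
    have hg0 := hg.2
    obtain ⟨G, h0, hn1, rfl⟩ := exists_extension g
    have hrec : ∀ i < n, G (i + 2) = x * G (i + 1) - G i - 0 := by
      intro i hi
      have := congrFun hgA ⟨i, hi⟩
      rw [toLin'_apply, adjMatrix_pathGraph_mulVec h0 hn1] at this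
      simp at this
      linarith
    have hsol := eq_of_recurrence (q := fun _ => 0) h0 hrec rfl rfl (by simp)
    have hG1 : G 1 ≠ 0 := by
      intro hz
      apply hg0
      ext i
      simp [hsol (i + 1) (by omega), hz]
    have := hsol (n + 1) le_rfl
    rw [hn1] at this
    simpa [hG1] using this.symm
  · intro h
    apply Module.End.hasEigenvalue_of_hasEigenvector (x := fun i : Fin n => chebSeq x (i + 1))
    rw [Module.End.hasEigenvector_iff, Module.End.mem_eigenspace_iff]
    refine ⟨?_, ?_⟩
    · ext i
      rw [toLin'_apply, adjMatrix_pathGraph_mulVec (chebSeq_zero x) h, chebSeq_add_two]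
      simp
    · intro hz
      have := congrFun hz ⟨0, hn⟩
      simp [chebSeq_one] at this

/-! ### Singularity of the pencil and roots of `Φₙ` -/

/-- The matrix `A - x I - (x + 2) J` with `A` the adjacency matrix of the path. -/
def pencil (n : ℕ) (x : ℝ) : Matrix (Fin n) (Fin n) ℝ := by
  classical exact (SimpleGraph.pathGraph n).adjMatrix ℝ - x • (1 : Matrix (Fin n) (Fin n) ℝ)
    - (x + 2) • Matrix.of fun _ _ => 1

lemma pencil_mulVec {n : ℕ} (x : ℝ) {G : ℕ → ℝ} (h0 : G 0 = 0) (hn : G (n + 1) = 0)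
    (i : Fin n) :
    (pencil n x *ᵥ fun j : Fin n => G (j + 1)) i
      = G i + G (i + 2) - x * G (i + 1) - (x + 2) * ∑ j ∈ Finset.range n, G (j + 1) := by
  classical
  rw [pencil, sub_mulVec, sub_mulVec, smul_mulVec, smul_mulVec, one_mulVec, Pi.sub_apply,
    Pi.sub_apply, adjMatrix_pathGraph_mulVec h0 hn]
  simp [mulVec, dotProduct, Fin.sum_univ_eq_sum_range (fun j => G (j + 1)) n]

/-- The two expressions differ by a multiple of the invariant form. -/
lemma fanPoly_eval_eq_det (n : ℕ) (x : ℝ) :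
    (fanPoly n).eval x =
      (x - 2) * chebSeq x (n + 1) * ((x - 2) + (x + 2) * (n - chebSeq x n))
        - (x + 2) * (1 - chebSeq x (n + 1) + chebSeq x n)
          * (chebSeq x (n + 1) - chebSeq x n - 1) := by
  rw [fanPoly_eval]
  linear_combination (-(x + 2)) * chebSeq_quadratic x n

lemma fanPoly_isRoot_iff {n : ℕ} (hn : 1 ≤ n) {x : ℝ} (hx : x ≠ 2) :
    (fanPoly n).IsRoot x ↔ ∃ g : Fin n → ℝ, g ≠ 0 ∧ pencil n x *ᵥ g = 0 := by
  have hy : x - 2 ≠ 0 := sub_ne_zero.2 hx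
  have hP := sum_chebSeq x n
  have hQ := sum_forcedSeq hx n
  have hq := forcedSeq_succ hx n
  -- The unknowns are `(G 1, s)`. The rows are `G (n + 1) = 0` and `∑ G = s`, each multiplied by `x
  -- - 2`.
  set N : Matrix (Fin 2) (Fin 2) ℝ :=
    !![(x - 2) * chebSeq x (n + 1), -(x + 2) * (1 - chebSeq x (n + 1) + chebSeq x n);
       chebSeq x (n + 1) - chebSeq x n - 1, -((x - 2) + (x + 2) * (n - chebSeq x n))] with hN
  have hdet : (fanPoly n).eval x = -N.det := by
    rw [fanPoly_eval_eq_det, hN, det_fin_two_of]; ring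
  rw [Polynomial.IsRoot, hdet, neg_eq_zero, ← exists_mulVec_eq_zero_iff]
  constructor
  · rintro ⟨v, hv0, hv⟩
    have e1 := congrFun hv 0
    have e2 := congrFun hv 1
    simp only [hN, mulVec, dotProduct, Fin.sum_univ_two, of_apply, cons_val_zero, cons_val_one,
      Pi.zero_apply, cons_val', cons_val_fin_one] at e1 e2
    set a := v 0
    set s := v 1
    let G : ℕ → ℝ := fun k => a * chebSeq x k + -(x + 2) * s * forcedSeq x k
    have h0 : G 0 = 0 := by simp [G, chebSeq_zero, forcedSeq_zero]
    have hn1 : G (n + 1) = 0 := by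
      apply mul_left_cancel₀ hy
      simp only [G]
      linear_combination e1 - (x + 2) * s * hq
    have hs : ∑ j ∈ Finset.range n, G (j + 1) = s := by
      apply mul_left_cancel₀ hy
      simp only [G, Finset.sum_add_distrib, ← Finset.mul_sum]
      linear_combination e2 + a * hP - (x + 2) * s * hQ
    refine ⟨fun j => G (j + 1), ?_, ?_⟩
    · intro hz
      have hz' : ∀ j < n, G (j + 1) = 0 := fun j hj => congrFun hz ⟨j, hj⟩
      have hs0 : s = 0 := by
        rw [← hs]; exact Finset.sum_eq_zero fun j hj => hz' j (Finset.mem_range.1 hj)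
      have ha0 : a = 0 := by
        have := hz' 0 hn
        simpa [G, chebSeq_one, forcedSeq_one] using this
      apply hv0
      ext i
      fin_cases i
      · exact ha0
      · exact hs0
    · ext i
      rw [pencil_mulVec x h0 hn1, hs]
      simp only [G, chebSeq_add_two, forcedSeq_add_two hx, Pi.zero_apply]
      ring
  · rintro ⟨g, hg0, hg⟩
    obtain ⟨G, h0, hn1, rfl⟩ := exists_extension g
    set s := ∑ j ∈ Finset.range n, G (j + 1) with hs
    have hrec : ∀ i < n, G (i + 2) = x * G (i + 1) - G i - -(x + 2) * s := by
      intro i hi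
      have := congrFun hg ⟨i, hi⟩
      rw [pencil_mulVec x h0 hn1] at this
      simp only [Pi.zero_apply] at this
      linarith
    have hsol := eq_of_recurrence (q := fun k => -(x + 2) * s * forcedSeq x k) h0 hrec
      (by simp [forcedSeq_zero]) (by simp [forcedSeq_one])
      (by intro i; simp only [forcedSeq_add_two hx]; ring)
    have hE1 := hsol (n + 1) le_rfl
    rw [hn1] at hE1
    have hE2 : s = G 1 * ∑ j ∈ Finset.range n, chebSeq x (j + 1)
        + -(x + 2) * s * ∑ j ∈ Finset.range n, forcedSeq x (j + 1) := by
      rw [Finset.mul_sum, Finset.mul_sum, ← Finset.sum_add_distrib]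
      refine hs.trans (Finset.sum_congr rfl fun j hj => ?_)
      exact hsol (j + 1) (by have := Finset.mem_range.1 hj; omega)
    refine ⟨![G 1, s], ?_, ?_⟩
    · intro hz
      have z1 : G 1 = 0 := by simpa using congrFun hz 0
      have z2 : s = 0 := by simpa using congrFun hz 1
      apply hg0
      ext i
      simp [hsol (i + 1) (by omega), z1, z2]
    · ext i
      fin_cases i
      · simp only [hN, mulVec, dotProduct, Fin.sum_univ_two]
        simp
        linear_combination -(x - 2) * hE1 + (x + 2) * s * hq
      · simp only [hN, mulVec, dotProduct, Fin.sum_univ_two]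
        simp
        linear_combination -(x - 2) * hE2 - G 1 * hP + (x + 2) * s * hQ

/-! ### The quadratic form of the fan -/

lemma fan_adj_inl_inr {n : ℕ} (a : Fin 1) (i : Fin n) :
    (fan n).Adj (Sum.inl a) (Sum.inr i) := by
  simp [fan, join, completeBipartiteGraph]

lemma fan_adj_inr_inr {n : ℕ} (i j : Fin n) :
    (fan n).Adj (Sum.inr i) (Sum.inr j) ↔ (SimpleGraph.pathGraph n).Adj i j := by
  simp [fan, join, completeBipartiteGraph]

lemma fan_dist_inl_inr {n : ℕ} (a : Fin 1) (i : Fin n) :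
    (fan n).dist (Sum.inl a) (Sum.inr i) = 1 :=
  SimpleGraph.dist_eq_one_iff_adj.2 (fan_adj_inl_inr a i)

lemma fan_dist_inr_inr {n : ℕ} {i j : Fin n} (hij : i ≠ j)
    (h : ¬ (SimpleGraph.pathGraph n).Adj i j) :
    (fan n).dist (Sum.inr i) (Sum.inr j) = 2 := by
  let w : (fan n).Walk (Sum.inr i) (Sum.inr j) :=
    .cons (fan_adj_inl_inr 0 i).symm (.cons (fan_adj_inl_inr 0 j) .nil)
  have h2 : (fan n).dist (Sum.inr i) (Sum.inr j) ≤ 2 := SimpleGraph.dist_le w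
  have h0 : (fan n).dist (Sum.inr i) (Sum.inr j) ≠ 0 := by
    intro h0
    rcases SimpleGraph.dist_eq_zero_iff_eq_or_not_reachable.1 h0 with h0 | h0
    · exact hij (Sum.inr_injective h0)
    · exact h0 ⟨w⟩
  have h1 : (fan n).dist (Sum.inr i) (Sum.inr j) ≠ 1 := by
    rw [Ne, SimpleGraph.dist_eq_one_iff_adj, fan_adj_inr_inr]
    exact h
  omega

lemma distMatrix_fan_inr_inr {n : ℕ} (i j : Fin n) :
    distMatrix (fan n) (Sum.inr i) (Sum.inr j)
      = (-pencil n 0 - (2 : ℝ) • (1 : Matrix (Fin n) (Fin n) ℝ)) i j := by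
  classical
  rw [distMatrix, of_apply, pencil]
  by_cases hij : i = j
  · subst hij
    simp
  · by_cases h : (SimpleGraph.pathGraph n).Adj i j
    · rw [SimpleGraph.dist_eq_one_iff_adj.2 ((fan_adj_inr_inr i j).2 h)]
      simp [hij, h]
      norm_num
    · rw [fan_dist_inr_inr hij h]
      simp [hij, h]

lemma fan_dotProduct_distMatrix {n : ℕ} {a : ℝ} {g : Fin n → ℝ} (ha : a + ∑ i, g i = 0) :
    Sum.elim (fun _ : Fin 1 => a) g ⬝ᵥ (distMatrix (fan n) *ᵥ Sum.elim (fun _ => a) g)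
      = -2 * (a ^ 2 + g ⬝ᵥ g) - g ⬝ᵥ (pencil n 0 *ᵥ g) := by
  have hl : ∀ k : Fin 1, (distMatrix (fan n) *ᵥ Sum.elim (fun _ => a) g) (Sum.inl k)
      = ∑ i, g i := by
    intro k
    simp [mulVec, dotProduct, distMatrix, fan_dist_inl_inr, Subsingleton.elim k 0]
  have hr : ∀ i : Fin n, (distMatrix (fan n) *ᵥ Sum.elim (fun _ => a) g) (Sum.inr i)
      = a + ((-pencil n 0 - (2 : ℝ) • (1 : Matrix (Fin n) (Fin n) ℝ)) *ᵥ g) i := by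
    intro i
    simp only [mulVec, dotProduct, Fintype.sum_sum_type, distMatrix_fan_inr_inr, Sum.elim_inl,
      Sum.elim_inr]
    simp [distMatrix, SimpleGraph.dist_comm, fan_dist_inl_inr]
  have hsplit : Sum.elim (fun _ : Fin 1 => a) g
        ⬝ᵥ (distMatrix (fan n) *ᵥ Sum.elim (fun _ => a) g)
      = a * ∑ i, g i + g ⬝ᵥ ((fun _ => a)
        + (-pencil n 0 - (2 : ℝ) • (1 : Matrix (Fin n) (Fin n) ℝ)) *ᵥ g) := by
    rw [dotProduct, Fintype.sum_sum_type]
    simp [hl, hr, dotProduct]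
  have hc : g ⬝ᵥ (fun _ => a) = a * ∑ i, g i := by
    rw [dotProduct, Finset.mul_sum]
    exact Finset.sum_congr rfl fun i _ => mul_comm _ _
  rw [hsplit, dotProduct_add, hc, sub_mulVec, dotProduct_sub, neg_mulVec, dotProduct_neg,
    smul_mulVec, one_mulVec, dotProduct_smul, smul_eq_mul]
  linear_combination 2 * a * ha

/-- The pencil is affine in `x` with slope `-(I + J)`, whose quadratic form is the squared norm of
the sum-zero extension to the fan. -/
lemma dotProduct_pencil {n : ℕ} (x : ℝ) (g : Fin n → ℝ) :
    g ⬝ᵥ (pencil n x *ᵥ g)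
      = g ⬝ᵥ (pencil n 0 *ᵥ g) - x * ((∑ i, g i) ^ 2 + g ⬝ᵥ g) := by
  classical
  have h : pencil n x = pencil n 0 - x • (1 : Matrix (Fin n) (Fin n) ℝ)
      - x • Matrix.of fun _ _ => 1 := by
    ext i j
    simp [pencil]
    ring
  have hJ : g ⬝ᵥ ((Matrix.of fun _ _ : Fin n => (1 : ℝ)) *ᵥ g) = (∑ i, g i) ^ 2 := by
    simp [mulVec, dotProduct, ← Finset.sum_mul, sq]
  rw [h, sub_mulVec, sub_mulVec, dotProduct_sub, dotProduct_sub, smul_mulVec, smul_mulVec,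
    one_mulVec, dotProduct_smul, dotProduct_smul, hJ]
  simp only [smul_eq_mul]
  ring

lemma pencil_isHermitian (n : ℕ) (x : ℝ) : (pencil n x).IsHermitian := by
  classical
  ext i j
  simp [pencil, SimpleGraph.adj_comm, one_apply, eq_comm]

/-- The values of the quadratic form of the fan, in terms of the restriction to the path. -/
lemma mem_qeValues_fan_iff {n : ℕ} (t : ℝ) :
    t ∈ qeValues (fan n) ↔ ∃ g : Fin n → ℝ, (∑ i, g i) ^ 2 + g ⬝ᵥ g = 1 ∧
      t = -2 - g ⬝ᵥ (pencil n 0 *ᵥ g) := by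
  constructor
  · rintro ⟨f, hf, h1, rfl⟩
    obtain ⟨a, g, rfl⟩ : ∃ (a : ℝ) (g : Fin n → ℝ), f = Sum.elim (fun _ => a) g :=
      ⟨f (Sum.inl 0), fun i => f (Sum.inr i), by
        ext (i | i)
        · simp [Subsingleton.elim i 0]
        · rfl⟩
    have ha : a + ∑ i, g i = 0 := by
      simpa [dotProduct, Fintype.sum_sum_type] using h1
    have hn : a ^ 2 + g ⬝ᵥ g = 1 := by
      simpa [dotProduct, Fintype.sum_sum_type, sq] using hf
    refine ⟨g, ?_, ?_⟩
    · rw [← hn]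
      linear_combination (∑ i, g i - a) * ha
    · rw [fan_dotProduct_distMatrix ha, hn]
      ring
  · rintro ⟨g, hg, rfl⟩
    refine ⟨Sum.elim (fun _ => -∑ i, g i) g, ?_, ?_, ?_⟩
    · rw [← hg]
      simp [dotProduct, Fintype.sum_sum_type, sq]
    · simp [dotProduct, Fintype.sum_sum_type]
    · rw [fan_dotProduct_distMatrix (by simp), neg_sq, hg]
      ring

lemma dotProduct_self_nonneg_real {ι : Type*} [Fintype ι] (g : ι → ℝ) : 0 ≤ g ⬝ᵥ g :=
  Finset.sum_nonneg fun i _ => mul_self_nonneg (g i)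

lemma sq_sum_add_pos {n : ℕ} {g : Fin n → ℝ} (hg : g ≠ 0) :
    0 < (∑ i, g i) ^ 2 + g ⬝ᵥ g := by
  have h : g ⬝ᵥ g ≠ 0 := fun h => hg (dotProduct_self_eq_zero.1 h)
  have := lt_of_le_of_ne (dotProduct_self_nonneg_real g) h.symm
  positivity

/-- The Rayleigh quotients of the pencil give values of the quadratic form. -/
lemma rayleigh_mem_qeValues {n : ℕ} {g : Fin n → ℝ} (hg : g ≠ 0) :
    -2 - g ⬝ᵥ (pencil n 0 *ᵥ g) / ((∑ i, g i) ^ 2 + g ⬝ᵥ g) ∈ qeValues (fan n) := by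
  have hpos := sq_sum_add_pos hg
  obtain ⟨N, hN⟩ : ∃ N, N = (∑ i, g i) ^ 2 + g ⬝ᵥ g := ⟨_, rfl⟩
  rw [← hN] at hpos ⊢
  rw [mem_qeValues_fan_iff]
  have hs := Real.mul_self_sqrt hpos.le
  have hne : √N ≠ 0 := (Real.sqrt_pos.2 hpos).ne'
  refine ⟨(√N)⁻¹ • g, ?_, ?_⟩
  · simp only [Pi.smul_apply, smul_dotProduct, dotProduct_smul, smul_eq_mul, ← Finset.mul_sum]
    rw [mul_pow, ← mul_assoc, ← sq, ← mul_add, ← hN, inv_pow, Real.sq_sqrt hpos.le,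
      inv_mul_cancel₀ hpos.ne']
  · rw [mulVec_smul]
    simp only [smul_dotProduct, dotProduct_smul, smul_eq_mul]
    rw [← mul_assoc, ← mul_inv, hs]
    ring

/-- This is the value at the normalised difference of the two ends of an edge at the hub. It keeps
`-QEC - 2` at or below `-1`, away from the exceptional point `2`. -/
lemma neg_one_mem_qeValues {n : ℕ} (hn : 1 ≤ n) : -1 ∈ qeValues (fan n) := by
  classical
  have hz : (Pi.single ⟨0, hn⟩ 1 : Fin n → ℝ) ≠ 0 := by simp
  have h := rayleigh_mem_qeValues hz
  convert h using 1
  simp [pencil]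
  norm_num

lemma isCompact_qeValues {n : ℕ} : IsCompact (qeValues (fan n)) := by
  let N : (Fin n → ℝ) → ℝ := fun g => (∑ i, g i) ^ 2 + g ⬝ᵥ g
  have hN : Continuous N := by
    simp only [N, dotProduct]
    fun_prop
  have himg : qeValues (fan n)
      = (fun g : Fin n → ℝ => -2 - g ⬝ᵥ (pencil n 0 *ᵥ g)) '' {g | N g = 1} := by
    ext t
    rw [mem_qeValues_fan_iff]
    simp only [Set.mem_image, Set.mem_ofPred_eq, N, eq_comm]
  rw [himg]
  refine IsCompact.image ?_ ?_
  · refine Metric.isCompact_of_isClosed_isBounded (isClosed_eq hN continuous_const) ?_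
    refine (Metric.isBounded_closedBall (x := (0 : Fin n → ℝ)) (r := 1)).subset ?_
    intro g hg
    rw [mem_closedBall_zero_iff, pi_norm_le_iff_of_nonneg zero_le_one]
    intro i
    have h1 : g i * g i ≤ g ⬝ᵥ g :=
      Finset.single_le_sum (f := fun i => g i * g i) (fun i _ => mul_self_nonneg (g i))
        (Finset.mem_univ i)
    have h2 : (∑ i, g i) ^ 2 + g ⬝ᵥ g = 1 := hg
    rw [Real.norm_eq_abs, abs_le_one_iff_mul_self_le_one]
    nlinarith [sq_nonneg (∑ i, g i)]
  · simp only [dotProduct, mulVec]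
    fun_prop

lemma isGreatest_QEC_fan {n : ℕ} (hn : 1 ≤ n) : IsGreatest (qeValues (fan n)) (QEC (fan n)) :=
  isCompact_qeValues.isGreatest_sSup ⟨_, neg_one_mem_qeValues hn⟩

theorem isLeast_isRoot_fanPoly {n : ℕ} (hn : 1 ≤ n) :
    IsLeast {x : ℝ | (fanPoly n).IsRoot x} (-QEC (fan n) - 2) := by
  obtain ⟨hmem, hub⟩ := isGreatest_QEC_fan hn
  have hle : -QEC (fan n) - 2 ≤ -1 := by linarith [hub (neg_one_mem_qeValues hn)]
  set α := -QEC (fan n) - 2 with hα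
  -- Maximality of `QEC` says exactly that the pencil at `α` is nonnegative; a maximiser makes the
  -- form vanish and so lies in the kernel.
  have hpsd : (pencil n α).PosSemidef := by
    refine .of_dotProduct_mulVec_nonneg (pencil_isHermitian n α) fun g => ?_
    rw [star_trivial]
    rcases eq_or_ne g 0 with rfl | hg
    · simp
    · have h := hub (rayleigh_mem_qeValues hg)
      have hpos := sq_sum_add_pos hg
      rw [dotProduct_pencil, sub_nonneg, ← le_div_iff₀ hpos]
      linarith
  constructor
  · obtain ⟨g, hg1, hg2⟩ := (mem_qeValues_fan_iff _).1 hmem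
    refine (fanPoly_isRoot_iff hn (by linarith)).2 ⟨g, ?_, ?_⟩
    · rintro rfl
      simp at hg1
    · rw [← hpsd.dotProduct_mulVec_zero_iff, star_trivial, dotProduct_pencil, hg1]
      linarith
  · intro x hx
    rcases eq_or_ne x 2 with rfl | hx2
    · linarith
    · obtain ⟨g, hg0, hg⟩ := (fanPoly_isRoot_iff hn hx2).1 hx
      have hpos := sq_sum_add_pos hg0
      have h := dotProduct_pencil x g
      rw [hg, dotProduct_zero] at h
      have hq : g ⬝ᵥ (pencil n 0 *ᵥ g) / ((∑ i, g i) ^ 2 + g ⬝ᵥ g) = x := by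
        rw [div_eq_iff hpos.ne']
        linarith
      have h2 := hub (rayleigh_mem_qeValues hg0)
      rw [hq] at h2
      linarith

/-! ### Location of the smallest root -/

lemma mul_sin_sq_le_one {m : ℕ} (hm : 3 ≤ m) {φ : ℝ} (h0 : 0 ≤ φ) (h : φ ≤ Real.pi / (2 * m)) :
    (m + 1 : ℝ) * Real.sin φ ^ 2 ≤ 1 := by
  have hπ := Real.pi_pos
  have hπ' := Real.pi_lt_d2
  -- The case `m = 3` is sharp, with equality at `φ = π / 6`. For `m ≥ 4` the bounds `sin φ ≤ φ` and
  -- `π ^ 2 < 10` suffice.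
  rcases hm.eq_or_lt with rfl | hm4
  · have hle : Real.sin φ ≤ 1 / 2 := by
      rw [← Real.sin_pi_div_six]
      push_cast at h
      exact Real.sin_le_sin_of_le_of_le_pi_div_two (by linarith) (by linarith) (by linarith)
    have hpos : 0 ≤ Real.sin φ :=
      Real.sin_nonneg_of_nonneg_of_le_pi h0 (by push_cast at h; linarith)
    push_cast
    nlinarith
  · have hm' : (4 : ℝ) ≤ m := by exact_mod_cast hm4
    have h1 : Real.sin φ ^ 2 ≤ φ ^ 2 := by
      rw [sq_le_sq, abs_of_nonneg h0]
      exact (Real.abs_sin_le_abs).trans_eq (abs_of_nonneg h0)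
    have h2 : 2 * m * φ ≤ Real.pi := by
      rw [le_div_iff₀ (by positivity)] at h
      linarith
    have h3 : (2 * m * φ) ^ 2 ≤ 10 := by
      have : (0 : ℝ) ≤ 2 * m * φ := by positivity
      nlinarith
    have h4 : (m + 1 : ℝ) * 10 ≤ 4 * m ^ 2 := by nlinarith
    have h5 : 4 * (m : ℝ) ^ 2 * ((m + 1) * Real.sin φ ^ 2) ≤ 4 * m ^ 2 * 1 := by
      calc 4 * (m : ℝ) ^ 2 * ((m + 1) * Real.sin φ ^ 2)
          ≤ 4 * (m : ℝ) ^ 2 * ((m + 1) * φ ^ 2) := by gcongr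
        _ = (m + 1) * (2 * m * φ) ^ 2 := by ring
        _ ≤ (m + 1) * 10 := by gcongr
        _ ≤ 4 * m ^ 2 * 1 := by linarith
    exact le_of_mul_le_mul_left h5 (by positivity)

/-- Beyond the range of `2 cos`, growth of `chebSeq` replaces trigonometry. -/
lemma exists_half_angle {θ y : ℝ} (h0 : 0 ≤ θ) (hπ : θ ≤ Real.pi) (hy : 2 * Real.cos θ < y) :
    2 ≤ y ∨ ∃ φ, 0 < φ ∧ 2 * φ < θ ∧ y = 2 * Real.cos (2 * φ) := by
  rcases le_or_gt 2 y with h | h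
  · exact Or.inl h
  · right
    have h1 : y / 2 < 1 := by linarith
    have h2 : -1 ≤ y / 2 := by linarith [Real.neg_one_le_cos θ]
    refine ⟨Real.arccos (y / 2) / 2, half_pos (Real.arccos_pos.2 h1), ?_, ?_⟩
    · rw [mul_div_cancel₀ _ two_ne_zero, ← Real.arccos_cos h0 hπ]
      exact Real.arccos_lt_arccos (Real.neg_one_le_cos θ) (by linarith) h1.le
    · rw [mul_div_cancel₀ _ two_ne_zero, Real.cos_arccos h2 h1.le]
      ring

lemma fanPoly_eval_neg_even {n : ℕ} (hn : Even n) (y : ℝ) :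
    (fanPoly n).eval (-y) = ((n + 1) * y ^ 2 + 6 * y - 4 * n) * chebSeq y (n + 1)
      + 2 * (y - 2) * (chebSeq y n - 1) := by
  rw [fanPoly_eval, (chebSeq_neg y n).1, (chebSeq_neg y n).2, hn.neg_one_pow]
  ring

lemma fanPoly_eval_neg_odd {n : ℕ} (hn : Odd n) (y : ℝ) :
    (fanPoly n).eval (-y) = -(((n + 1) * y ^ 2 + 6 * y - 4 * n) * chebSeq y (n + 1)
      + 2 * (y - 2) * (chebSeq y n + 1)) := by
  rw [fanPoly_eval, (chebSeq_neg y n).1, (chebSeq_neg y n).2, hn.neg_one_pow]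
  ring

lemma chebSeq_half_angle (n : ℕ) (φ : ℝ) :
    chebSeq (2 * Real.cos (2 * φ)) (n + 1) * (2 * Real.sin φ * Real.cos φ)
        = 2 * Real.sin ((n + 1) * φ) * Real.cos ((n + 1) * φ) ∧
      chebSeq (2 * Real.cos (2 * φ)) n * (2 * Real.sin φ * Real.cos φ)
        = 2 * Real.sin ((n + 1) * φ) * Real.cos ((n + 1) * φ) * Real.cos (2 * φ)
          - Real.cos (2 * ((n + 1) * φ)) * (2 * Real.sin φ * Real.cos φ) := by
  rw [← Real.sin_two_mul, ← Real.sin_two_mul, chebSeq_cos, chebSeq_cos]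
  refine ⟨by congr 1; push_cast; ring, ?_⟩
  rw [← Real.sin_sub]
  congr 1
  ring

/-- For even `n` the term `chebSeq y n - 1`, once multiplied by `sin 2φ`, shares the factor `cos
((n+1)φ)` with `chebSeq y (n + 1)`. For odd `n`, `chebSeq y n + 1` shares `sin ((n+1)φ)` instead. -/
lemma fanPoly_eval_cos_even {n : ℕ} (hn : Even n) {φ : ℝ} (hc : Real.cos φ ≠ 0) :
    Real.sin φ * (fanPoly n).eval (-(2 * Real.cos (2 * φ))) =
      16 * Real.cos ((n + 1) * φ) *
        (Real.cos φ * (1 - (n + 2) * Real.sin φ ^ 2) * Real.sin ((n + 1) * φ)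
          + Real.sin φ ^ 3 * Real.cos ((n + 1) * φ)) := by
  obtain ⟨h1, h2⟩ := chebSeq_half_angle n φ
  rw [fanPoly_eval_neg_even hn]
  have h3 := Real.sin_sq_add_cos_sq φ
  rw [Real.cos_two_mul ((n + 1) * φ)] at h2
  have hC : Real.cos (2 * φ) = 1 - 2 * Real.sin φ ^ 2 := by rw [Real.cos_two_mul]; linarith
  rw [hC] at h1 h2 ⊢
  apply mul_left_cancel₀ (mul_ne_zero two_ne_zero hc)
  linear_combination ((n + 1) * (2 * (1 - 2 * Real.sin φ ^ 2)) ^ 2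
    + 6 * (2 * (1 - 2 * Real.sin φ ^ 2)) - 4 * n) * h1
    + 2 * (2 * (1 - 2 * Real.sin φ ^ 2) - 2) * h2
    - 32 * Real.sin ((n + 1) * φ) * Real.cos ((n + 1) * φ) * (1 - (n + 2) * Real.sin φ ^ 2) * h3

lemma fanPoly_eval_cos_odd {n : ℕ} (hn : Odd n) {φ : ℝ} (hc : Real.cos φ ≠ 0) :
    Real.sin φ * (fanPoly n).eval (-(2 * Real.cos (2 * φ))) =
      -(16 * Real.sin ((n + 1) * φ) *
        (Real.cos φ * (1 - (n + 2) * Real.sin φ ^ 2) * Real.cos ((n + 1) * φ)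
          - Real.sin φ ^ 3 * Real.sin ((n + 1) * φ))) := by
  obtain ⟨h1, h2⟩ := chebSeq_half_angle n φ
  rw [fanPoly_eval_neg_odd hn]
  have h3 := Real.sin_sq_add_cos_sq φ
  have hK : Real.cos (2 * ((n + 1) * φ)) = 1 - 2 * Real.sin ((n + 1) * φ) ^ 2 := by
    rw [Real.cos_two_mul]; linarith [Real.sin_sq_add_cos_sq ((n + 1) * φ)]
  have hC : Real.cos (2 * φ) = 1 - 2 * Real.sin φ ^ 2 := by rw [Real.cos_two_mul]; linarith
  rw [hK] at h2
  rw [hC] at h1 h2 ⊢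
  apply mul_left_cancel₀ (mul_ne_zero two_ne_zero hc)
  linear_combination (-((n + 1) * (2 * (1 - 2 * Real.sin φ ^ 2)) ^ 2
    + 6 * (2 * (1 - 2 * Real.sin φ ^ 2)) - 4 * n)) * h1
    - 2 * (2 * (1 - 2 * Real.sin φ ^ 2) - 2) * h2
    + 32 * Real.sin ((n + 1) * φ) * Real.cos ((n + 1) * φ) * (1 - (n + 2) * Real.sin φ ^ 2) * h3

lemma fanPoly_coeff_pos (n : ℕ) {y : ℝ} (hy : 2 ≤ y) :
    0 < (n + 1) * y ^ 2 + 6 * y - 4 * (n : ℝ) := by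
  have h : (0 : ℝ) ≤ n := n.cast_nonneg
  nlinarith [mul_nonneg h (by nlinarith : (0 : ℝ) ≤ y ^ 2 - 4)]

lemma chebSeq_succ_pos {n : ℕ} {y : ℝ} (hy : 2 * Real.cos (Real.pi / (n + 1)) < y) :
    0 < chebSeq y (n + 1) := by
  have hn : (0 : ℝ) < n + 1 := by positivity
  have hπ := Real.pi_pos
  have hle : Real.pi / (n + 1) ≤ Real.pi := div_le_self hπ.le (by linarith [n.cast_nonneg (α := ℝ)])
  rcases exists_half_angle (by positivity) hle hy with h | ⟨φ, h0, h1, rfl⟩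
  · have := (chebSeq_growth h (n + 1)).1
    push_cast at this
    linarith
  · have h2 := chebSeq_cos (2 * φ) (n + 1)
    have h3 : 0 < Real.sin (2 * φ) := Real.sin_pos_of_pos_of_lt_pi (by linarith) (by linarith)
    have h4 : 0 < Real.sin ((n + 1 : ℕ) * (2 * φ)) := by
      refine Real.sin_pos_of_pos_of_lt_pi (by positivity) ?_
      rw [lt_div_iff₀ hn] at h1
      push_cast
      linarith
    rw [← h2] at h4
    exact pos_of_mul_pos_left h4 h3.le

theorem isLeast_evPath {n : ℕ} (hn : 1 ≤ n) :
    IsLeast (evPath n) (-2 * Real.cos (Real.pi / (n + 1))) := by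
  have hn' : (1 : ℝ) ≤ n := by exact_mod_cast hn
  have hπ := Real.pi_pos
  have hneg : ∀ y, -y ∈ evPath n ↔ chebSeq y (n + 1) = 0 := by
    intro y
    rw [mem_evPath_iff hn, (chebSeq_neg y n).1]
    simp
  constructor
  · rw [neg_mul, hneg]
    have h := chebSeq_cos (Real.pi / (n + 1)) (n + 1)
    have h1 : ((n + 1 : ℕ) : ℝ) * (Real.pi / (n + 1)) = Real.pi := by push_cast; field_simp
    rw [h1, Real.sin_pi] at h
    refine (mul_eq_zero.1 h).resolve_right (Real.sin_pos_of_pos_of_lt_pi (by positivity) ?_).ne'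
    exact div_lt_self hπ (by linarith)
  · intro x hx
    rw [← neg_neg x, hneg] at hx
    by_contra! hlt
    exact (chebSeq_succ_pos (y := -x) (n := n) (by linarith)).ne' hx

/-- Bounds for an angle `0 < φ ≤ π / (2 m)`. -/
lemma half_angle_bounds {m : ℕ} (hm : 3 ≤ m) {φ : ℝ} (h0 : 0 < φ) (h : 2 * φ ≤ Real.pi / m) :
    0 < Real.sin φ ∧ 0 < Real.cos φ ∧
      (m + 1 : ℝ) * Real.sin φ ^ 2 ≤ 1 := by
  have hm' : (3 : ℝ) ≤ m := by exact_mod_cast hm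
  have h1 : φ * (2 * m) ≤ Real.pi := by
    rw [le_div_iff₀ (by positivity)] at h
    linarith
  have h2 : φ < Real.pi / 2 := by nlinarith
  refine ⟨Real.sin_pos_of_pos_of_lt_pi h0 (by linarith),
    Real.cos_pos_of_mem_Ioo ⟨by linarith, h2⟩, mul_sin_sq_le_one hm h0.le ?_⟩
  rw [le_div_iff₀ (by positivity)]
  exact h1

lemma fanPoly_eval_pos_even {n : ℕ} (hn : 1 ≤ n) (he : Even n) {y : ℝ}
    (hy : 2 * Real.cos (Real.pi / (n + 1)) < y) : 0 < (fanPoly n).eval (-y) := by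
  have hn2 : 2 ≤ n := by obtain ⟨k, rfl⟩ := he; omega
  have hn2' : (2 : ℝ) ≤ n := by exact_mod_cast hn2
  have hπ := Real.pi_pos
  rcases exists_half_angle (by positivity) (div_le_self hπ.le (by linarith)) hy with
    h | ⟨φ, h0, h1, rfl⟩
  · rw [fanPoly_eval_neg_even he]
    have hp := chebSeq_succ_pos hy
    have hp' := (chebSeq_growth h n).1
    have := mul_pos (fanPoly_coeff_pos n h) hp
    have := mul_nonneg (by linarith : 0 ≤ 2 * (y - 2)) (by linarith : 0 ≤ chebSeq y n - 1)
    linarith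
  · obtain ⟨hs, hc, hb⟩ := half_angle_bounds (m := n + 1) (by omega) h0
      (by push_cast; exact h1.le)
    have hlt : (n + 1) * φ < Real.pi / 2 := by
      rw [lt_div_iff₀ (by positivity)] at h1
      linarith
    have hpos : 0 < (n + 1) * φ := by positivity
    have hK : 0 < Real.cos ((n + 1) * φ) := Real.cos_pos_of_mem_Ioo ⟨by linarith, hlt⟩
    have hS : 0 < Real.sin ((n + 1) * φ) := Real.sin_pos_of_pos_of_lt_pi hpos (by linarith)
    push_cast at hb
    have hb' : 0 ≤ 1 - (n + 2) * Real.sin φ ^ 2 := by linarith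
    refine pos_of_mul_pos_right ?_ hs.le
    rw [fanPoly_eval_cos_even he hc.ne']
    positivity

lemma fanPoly_eval_neg_of_two_le {n : ℕ} (ho : Odd n) {y : ℝ} (hy : 2 ≤ y) :
    (fanPoly n).eval (-y) < 0 := by
  rw [fanPoly_eval_neg_odd ho, neg_lt_zero]
  have hp := (chebSeq_growth hy (n + 1)).1
  have hp' := (chebSeq_growth hy n).1
  have h0 : (0 : ℝ) ≤ n := n.cast_nonneg
  push_cast at hp
  have := mul_pos (fanPoly_coeff_pos n hy) (by linarith : 0 < chebSeq y (n + 1))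
  have := mul_nonneg (by linarith : 0 ≤ 2 * (y - 2)) (by linarith : 0 ≤ chebSeq y n + 1)
  linarith

lemma fanPoly_eval_neg_odd_lt {n : ℕ} (ho : Odd n) {y : ℝ}
    (hy : 2 * Real.cos (Real.pi / (n + 2)) < y) : (fanPoly n).eval (-y) < 0 := by
  have hn : 1 ≤ n := ho.pos
  have hn' : (1 : ℝ) ≤ n := by exact_mod_cast hn
  have hπ := Real.pi_pos
  rcases exists_half_angle (by positivity) (div_le_self hπ.le (by linarith)) hy with
    h | ⟨φ, h0, h1, rfl⟩
  · exact fanPoly_eval_neg_of_two_le ho h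
  · obtain ⟨hs, hc, hb⟩ := half_angle_bounds (m := n + 2) (by omega) h0
      (by push_cast; exact h1.le)
    -- Here `(n+1)φ` and `φ` add up to less than a right angle, which compares the sine of each with
    -- the cosine of the other.
    have hlt : (n + 1) * φ < Real.pi / 2 - φ := by
      rw [lt_div_iff₀ (by positivity)] at h1
      linarith
    have hpos : 0 < (n + 1) * φ := by positivity
    have hK : Real.sin φ < Real.cos ((n + 1) * φ) := by
      rw [← Real.cos_pi_div_two_sub]
      exact Real.cos_lt_cos_of_nonneg_of_le_pi hpos.le (by linarith) hlt
    have hS : 0 < Real.sin ((n + 1) * φ) := Real.sin_pos_of_pos_of_lt_pi hpos (by linarith)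
    have hS' : Real.sin ((n + 1) * φ) < Real.cos φ := by
      rw [← Real.sin_pi_div_two_sub]
      exact Real.sin_lt_sin_of_lt_of_le_pi_div_two (by linarith) (by linarith) hlt
    push_cast at hb
    -- Taking `m = n + 2` gives `(n+3) sin² φ ≤ 1`, which leaves one spare `sin² φ`.
    have hb' : Real.sin φ ^ 2 ≤ 1 - (n + 2) * Real.sin φ ^ 2 := by linarith
    have hkey : Real.sin φ ^ 3 * Real.sin ((n + 1) * φ)
        < Real.cos φ * (1 - (n + 2) * Real.sin φ ^ 2) * Real.cos ((n + 1) * φ) :=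
      calc Real.sin φ ^ 3 * Real.sin ((n + 1) * φ)
          < Real.sin φ ^ 3 * Real.cos φ := by gcongr
        _ = Real.cos φ * Real.sin φ ^ 2 * Real.sin φ := by ring
        _ ≤ Real.cos φ * (1 - (n + 2) * Real.sin φ ^ 2) * Real.cos ((n + 1) * φ) :=
            mul_le_mul (mul_le_mul_of_nonneg_left hb' hc.le) hK.le hs.le
              (mul_nonneg hc.le ((sq_nonneg _).trans hb'))
    have h2 := fanPoly_eval_cos_odd ho hc.ne'
    have h3 := mul_pos (mul_pos (by norm_num : (0 : ℝ) < 16) hS) (sub_pos.2 hkey)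
    have h4 : Real.sin φ * (fanPoly n).eval (-(2 * Real.cos (2 * φ))) < 0 := by linarith
    exact (pos_iff_neg_of_mul_neg h4).1 hs

lemma half_angle_at_min_eigenvalue {n : ℕ} (hn : 1 ≤ n) :
    ∃ φ : ℝ, 2 * φ = Real.pi / (n + 1) ∧ (n + 1) * φ = Real.pi / 2 ∧
      0 < Real.sin φ ∧ 0 < Real.cos φ := by
  have hn' : (1 : ℝ) ≤ n := by exact_mod_cast hn
  have hπ := Real.pi_pos
  have h1 : Real.pi / (n + 1) < Real.pi := div_lt_self hπ (by linarith)
  have h0 : 0 < Real.pi / (n + 1) := by positivity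
  refine ⟨Real.pi / (n + 1) / 2, by ring, by field_simp, ?_, ?_⟩
  · exact Real.sin_pos_of_pos_of_lt_pi (by linarith) (by linarith)
  · exact Real.cos_pos_of_mem_Ioo ⟨by linarith, by linarith⟩

lemma fanPoly_isRoot_even {n : ℕ} (hn : 1 ≤ n) (he : Even n) :
    (fanPoly n).IsRoot (-2 * Real.cos (Real.pi / (n + 1))) := by
  obtain ⟨φ, h2, h1, hs, hc⟩ := half_angle_at_min_eigenvalue hn
  have h := fanPoly_eval_cos_even he hc.ne'
  rw [h1, Real.cos_pi_div_two, mul_zero, zero_mul] at h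
  rw [neg_mul, ← h2]
  exact (mul_eq_zero.1 h).resolve_left hs.ne'

lemma exists_root_lt_odd {n : ℕ} (ho : Odd n) :
    ∃ x, (fanPoly n).IsRoot x ∧ x < -2 * Real.cos (Real.pi / (n + 1)) := by
  obtain ⟨φ, h2, h1, hs, hc⟩ := half_angle_at_min_eigenvalue ho.pos
  have h := fanPoly_eval_cos_odd ho hc.ne'
  rw [h1, Real.cos_pi_div_two, Real.sin_pi_div_two] at h
  have hpos : 0 < (fanPoly n).eval (-(2 * Real.cos (2 * φ))) := by
    refine pos_of_mul_pos_right (a := Real.sin φ) ?_ hs.le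
    rw [h]
    have := pow_pos hs 3
    linarith
  -- `Φₙ` is negative at `-2` and positive at the least path eigenvalue, so it vanishes strictly
  -- between.
  have hneg := fanPoly_eval_neg_of_two_le ho le_rfl
  have hle : (-2 : ℝ) ≤ -(2 * Real.cos (2 * φ)) := by linarith [Real.cos_le_one (2 * φ)]
  obtain ⟨x, hx, hx0⟩ := intermediate_value_Ioo hle (fanPoly n).continuous.continuousOn
    (show (0 : ℝ) ∈ Set.Ioo _ _ from ⟨hneg, hpos⟩)
  refine ⟨x, hx0, ?_⟩
  rw [neg_mul, ← h2]
  exact hx.2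

lemma two_mul_cos_sub_two (c : ℝ) :
    2 * Real.cos (Real.pi / c) - 2 = -4 * Real.sin (Real.pi / (2 * c)) ^ 2 := by
  have h : Real.pi / c = 2 * (Real.pi / (2 * c)) := by ring
  rw [h, Real.cos_two_mul]
  linarith [Real.sin_sq_add_cos_sq (Real.pi / (2 * c))]

end QEFan

end

theorem mainTheorem1 (n : ℕ) (hn : 1 ≤ n) :
    ∃ α : ℝ,
      IsLeast {x : ℝ | (QEFan.fanPoly n).IsRoot x} α ∧
      IsGreatest (QEFan.qeValues (QEFan.fan n)) (QEFan.QEC (QEFan.fan n)) ∧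
      QEFan.QEC (QEFan.fan n) = -α - 2 ∧
      (Even n →
        IsLeast (QEFan.evPath n) α ∧
        α = -2 * Real.cos (Real.pi / ((n : ℝ) + 1)) ∧
        QEFan.QEC (QEFan.fan n) = -4 * Real.sin (Real.pi / (2 * ((n : ℝ) + 1))) ^ 2) ∧
      (Odd n →
        (∃ β : ℝ, IsLeast (QEFan.evPath (n + 1)) β ∧ β ≤ α) ∧
        (∃ γ : ℝ, IsLeast (QEFan.evPath n) γ ∧ α < γ) ∧
        -4 * Real.sin (Real.pi / (2 * ((n : ℝ) + 1))) ^ 2 < QEFan.QEC (QEFan.fan n) ∧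
        QEFan.QEC (QEFan.fan n) ≤ -4 * Real.sin (Real.pi / (2 * ((n : ℝ) + 2))) ^ 2) := by
  have hα := QEFan.isLeast_isRoot_fanPoly hn
  have hev := QEFan.isLeast_evPath hn
  refine ⟨_, hα, QEFan.isGreatest_QEC_fan hn, by ring, fun he => ?_, fun ho => ?_⟩
  · have heq : -QEFan.QEC (QEFan.fan n) - 2 = -2 * Real.cos (Real.pi / (n + 1)) := by
      refine le_antisymm (hα.2 (QEFan.fanPoly_isRoot_even hn he)) ?_
      by_contra! hlt
      have h := QEFan.fanPoly_eval_pos_even hn he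
        (y := -(-QEFan.QEC (QEFan.fan n) - 2)) (by linarith)
      rw [neg_neg] at h
      exact h.ne' hα.1
    refine ⟨heq ▸ hev, heq, ?_⟩
    rw [← QEFan.two_mul_cos_sub_two]
    linarith
  · have hlow : -2 * Real.cos (Real.pi / (n + 2)) ≤ -QEFan.QEC (QEFan.fan n) - 2 := by
      by_contra! hlt
      have h := QEFan.fanPoly_eval_neg_odd_lt ho
        (y := -(-QEFan.QEC (QEFan.fan n) - 2)) (by linarith)
      rw [neg_neg] at h
      exact h.ne hα.1
    obtain ⟨x, hx, hxlt⟩ := QEFan.exists_root_lt_odd ho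
    have hup := (hα.2 hx).trans_lt hxlt
    refine ⟨⟨_, QEFan.isLeast_evPath (Nat.le_add_left 1 n), ?_⟩, ⟨_, hev, hup⟩, ?_, ?_⟩
    · have e : ((n + 1 : ℕ) : ℝ) + 1 = n + 2 := by push_cast; ring
      rw [e]
      exact hlow
    · rw [← QEFan.two_mul_cos_sub_two]
      linarith
    · rw [← QEFan.two_mul_cos_sub_two]
      linarith
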